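/- Let $N\in\mathbb N$ and let $G:\mathbb R^N\to[0,\infty)$ satisfy: $G(0)=0$; $G$ is convex; $G$ is even; $\lim_{|x|\to\infty}G(x)/|x|=\infty$; there are $K_1\ge 2$, $M_1>0$ with $G(2x)\le K_1G(x)$ for all $|x|\ge M_1$ (condition $\Delta_2$); there are $K_2\ge 1$, $M_2>0$ with $G(x)\le\frac1{2K_2}G(K_2x)$ for all $|x|\ge M_2$ (condition $\nabla_2$). Let $G^*(y)=\sup_{x\in\mathbb R^N}\big(\langle x,y\rangle-G(x)\big)$ be its Fenchel conjugate, which has the same properties. Let $I\subset\mathbb R$ be an interval of finite length. For $H\in\{G,G^*\}$ let $L^H=L^H(I,\mathbb R^N)$ be the vector space of measurable $u:I\to\mathbb R^N$ with $\int_I H(u)\,dt<\infty$ (functions equal almost everywhere being identified), with the Luxemburg norm $\|u\|_{L^H}=\inf\{\alpha>0:\int_I H(u/\alpha)\,dt\le 1\}$. Then $\langle u,v\rangle$ is integrable on $I$ for all $u\in L^G$, $v\in L^{G^*}$, and for every bounded linear functional $F\in(L^G)^*$ there exists a unique $v\in L^{G^*}$ such that $$F(u)=\int_I\langle u,v\rangle\,dt\qquad\text{for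 every }u\in L^G.$$ Moreover, $(L^G)^*$ is identified with $L^{G^*}$: the map $v\mapsto F_v$, $F_v(u)=\int_I\langle u,v\rangle\,dt$, is a linear homeomorphism of $L^{G^*}$ onto $(L^G)^*$, and $\|v\|_{L^{G^*}}\le\|F_v\|\le 2\|v\|_{L^{G^*}}$ for every $v\in L^{G^*}$. -/

import Mathlib

open MeasureTheory Filter Topology
open scoped RealInnerProductSpace

/-- `ℝ^N` with its standard inner product and the induced norm. -/
abbrev RN (N : ℕ) : Type := EuclideanSpace ℝ (Fin N)

/-- The admissible G-functions `G : ℝ^N → [0, ∞)`: vanishing at `0`, convex, even, supercoercive,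
satisfying the `Δ₂` and the `∇₂` condition. -/
structure GFunction (N : ℕ) where
  toFun : RN N → ℝ
  nonneg : ∀ x, 0 ≤ toFun x
  map_zero : toFun 0 = 0
  convex : ConvexOn ℝ Set.univ toFun
  even : ∀ x, toFun (-x) = toFun x
  supercoercive : Tendsto (fun x => toFun x / ‖x‖) (Bornology.cobounded (RN N)) atTop
  delta2 : ∃ K : ℝ, 2 ≤ K ∧ ∃ M : ℝ, 0 < M ∧
    ∀ x, M ≤ ‖x‖ → toFun ((2 : ℝ) • x) ≤ K * toFun x
  nabla2 : ∃ K : ℝ, 1 ≤ K ∧ ∃ M : ℝ, 0 < M ∧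
    ∀ x, M ≤ ‖x‖ → toFun x ≤ 1 / (2 * K) * toFun (K • x)

namespace GFunction

variable {N : ℕ}

instance : CoeFun (GFunction N) (fun _ => RN N → ℝ) := ⟨GFunction.toFun⟩

/-- The value at `y` of the Fenchel conjugate, `sup_x (⟨x, y⟩ - G x)`. The supremum is finite, see
`GFunction.bddAbove_conj`. -/
noncomputable def conjFun (G : GFunction N) (y : RN N) : ℝ := ⨆ x : RN N, (⟪x, y⟫ - G x)

theorem continuous (G : GFunction N) : Continuous G.toFun := by
  have h := G.convex.continuousOn isOpen_univ
  exact continuousOn_univ.1 h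

theorem superlinear (G : GFunction N) (c : ℝ) : ∃ R : ℝ, 0 < R ∧ ∀ x, R ≤ ‖x‖ → c * ‖x‖ ≤ G x := by
  have h := G.supercoercive.eventually_ge_atTop c
  obtain ⟨R, -, hR⟩ := (Metric.hasBasis_cobounded_compl_closedBall (0 : RN N)).eventually_iff.1 h
  refine ⟨max R 0 + 1, by positivity, fun x hx => ?_⟩
  have h0 : 0 < ‖x‖ := by linarith [le_max_right R 0]
  have h1 : R < ‖x‖ := by linarith [le_max_left R 0]
  have h2 := hR (x := x) (by simpa using h1)
  exact (le_div_iff₀ h0).1 h2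

theorem bounded_ball (G : GFunction N) (R : ℝ) : ∃ C : ℝ, 0 ≤ C ∧ ∀ x, ‖x‖ ≤ R → G x ≤ C := by
  obtain ⟨C, hC⟩ := (isCompact_closedBall (0 : RN N) R).bddAbove_image G.continuous.continuousOn
  refine ⟨max C 0, le_max_right _ _, fun x hx => le_max_of_le_left (hC ⟨x, ?_, rfl⟩)⟩
  simpa using hx

theorem bddAbove_conj (G : GFunction N) (y : RN N) :
    BddAbove (Set.range fun x : RN N => ⟪x, y⟫ - G x) := by
  obtain ⟨R, hR0, hR⟩ := G.superlinear ‖y‖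
  refine ⟨R * ‖y‖, ?_⟩
  rintro _ ⟨x, rfl⟩
  have h1 := real_inner_le_norm x y
  rcases le_total R ‖x‖ with h | h
  · have := hR x h
    have : 0 ≤ R * ‖y‖ := by positivity
    simp only
    nlinarith
  · have := mul_le_mul_of_nonneg_right h (norm_nonneg y)
    have := G.nonneg x
    simp only
    linarith

/-- The Fenchel inequality. -/
theorem le_conj (G : GFunction N) (x y : RN N) : ⟪x, y⟫ - G x ≤ G.conjFun y :=
  le_ciSup (G.bddAbove_conj y) x

theorem conj_le (G : GFunction N) {y : RN N} {c : ℝ} (h : ∀ x : RN N, ⟪x, y⟫ - G x ≤ c) :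
    G.conjFun y ≤ c := ciSup_le h

theorem conj_nonneg (G : GFunction N) (y : RN N) : 0 ≤ G.conjFun y := by
  have := G.le_conj 0 y
  simpa [G.map_zero] using this

theorem conj_superlinear (G : GFunction N) (c : ℝ) (hc : 0 ≤ c) :
    ∃ R : ℝ, 0 < R ∧ ∀ y, R ≤ ‖y‖ → c * ‖y‖ ≤ G.conjFun y := by
  obtain ⟨C, hC0, hC⟩ := G.bounded_ball (c + 1)
  refine ⟨C + 1, by positivity, fun y hy => ?_⟩
  have hy0 : 0 < ‖y‖ := by linarith
  have h1 := G.le_conj (((c + 1) / ‖y‖) • y) y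
  have h2 : ‖((c + 1) / ‖y‖) • y‖ ≤ c + 1 := by
    rw [norm_smul, Real.norm_of_nonneg (by positivity)]
    exact (div_mul_cancel₀ _ hy0.ne').le
  have h3 := hC _ h2
  have h4 : ⟪((c + 1) / ‖y‖) • y, y⟫ = (c + 1) * ‖y‖ := by
    rw [real_inner_smul_left, real_inner_self_eq_norm_sq]
    field_simp
  rw [h4] at h1
  linarith

/-- The Fenchel conjugate `G*`; it is again an admissible G-function. -/
noncomputable def conj (G : GFunction N) : GFunction N where
  toFun := G.conjFun
  nonneg := G.conj_nonneg
  map_zero := by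
    refine le_antisymm (G.conj_le fun x => ?_) (G.conj_nonneg 0)
    simpa using G.nonneg x
  convex := by
    refine ⟨convex_univ, fun x _ y _ a b ha hb hab => G.conj_le fun z => ?_⟩
    have h1 := mul_le_mul_of_nonneg_left (G.le_conj z x) ha
    have h2 := mul_le_mul_of_nonneg_left (G.le_conj z y) hb
    have h3 : G z = a * G z + b * G z := by rw [← add_mul, hab, one_mul]
    rw [inner_add_right, real_inner_smul_right, real_inner_smul_right, smul_eq_mul, smul_eq_mul]
    linarith
  even := by
    have key : ∀ y, G.conjFun (-y) ≤ G.conjFun y := fun y => G.conj_le fun x => by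
      have := G.le_conj (-x) y
      rwa [G.even, inner_neg_left, ← inner_neg_right] at this
    intro y
    refine le_antisymm (key y) ?_
    simpa using key (-y)
  supercoercive := by
    refine tendsto_atTop.2 fun c => ?_
    obtain ⟨R, hR0, hR⟩ := G.conj_superlinear (max c 0) (le_max_right _ _)
    filter_upwards [(Metric.hasBasis_cobounded_compl_closedBall (0 : RN N)).mem_of_mem
      (i := R) trivial] with y hy
    have hy' : R < ‖y‖ := by simpa using hy
    have h0 : 0 < ‖y‖ := hR0.trans hy'
    rw [le_div_iff₀ h0]
    exact (mul_le_mul_of_nonneg_right (le_max_left c 0) h0.le).trans (hR y hy'.le)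
  delta2 := by
    obtain ⟨K, hK, M, hM, h⟩ := G.nabla2
    obtain ⟨R, hR0, hR⟩ := G.conj_superlinear 1 zero_le_one
    refine ⟨2 * K * (M + 1), by nlinarith, R, hR0, fun y hy => G.conj_le fun x => ?_⟩
    have hK0 : 0 < K := by linarith
    obtain ⟨z, rfl⟩ : ∃ z, x = K • z := ⟨K⁻¹ • x, by rw [smul_smul, mul_inv_cancel₀ hK0.ne', one_smul]⟩
    rw [real_inner_smul_left, real_inner_smul_right]
    have hy1 := hR y hy
    have hc := G.conj_nonneg y
    rcases le_total M ‖z‖ with hz | hz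
    · have h1 := h z hz
      have h2 : 2 * K * G z ≤ G (K • z) := by
        have := mul_le_mul_of_nonneg_left h1 (by positivity : 0 ≤ 2 * K)
        rwa [← mul_assoc, mul_one_div_cancel (by positivity), one_mul] at this
      have h3 := mul_le_mul_of_nonneg_left (G.le_conj z y) (by positivity : 0 ≤ 2 * K)
      have h4 : 0 ≤ 2 * K * M * G.conjFun y := by positivity
      nlinarith
    · have h1 := real_inner_le_norm z y
      have h2 := mul_le_mul_of_nonneg_right hz (norm_nonneg y)
      have h3 : ⟪z, y⟫ ≤ M * G.conjFun y := by nlinarith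
      have h4 := mul_le_mul_of_nonneg_left h3 (by positivity : 0 ≤ 2 * K)
      have h5 := G.nonneg (K • z)
      have h6 : 0 ≤ 2 * K * G.conjFun y := by positivity
      nlinarith
  nabla2 := by
    obtain ⟨K, hK, M, hM, h⟩ := G.delta2
    obtain ⟨R, hR0, hR⟩ := G.conj_superlinear M hM.le
    obtain ⟨R', hR0', hR'⟩ := G.conj_superlinear (M + 1) (by positivity)
    refine ⟨K / 2, by linarith, R', hR0', fun y hy => ?_⟩
    have hK0 : 0 < K := by linarith
    have e : 1 / (2 * (K / 2)) = K⁻¹ := by field_simp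
    rw [e]
    have hy0 : 0 < ‖y‖ := hR0'.trans_le hy
    have hlt : M * ‖y‖ < G.conjFun y := by nlinarith [hR' y hy]
    have hcase : ∀ z : RN N, ⟪z, y⟫ - G z ≤ max (M * ‖y‖) (K⁻¹ * G.conjFun ((K / 2) • y)) := by
      intro z
      rcases le_total M ‖z‖ with hz | hz
      · refine le_max_of_le_right ?_
        have h1 := h z hz
        have h2 := G.le_conj ((2 : ℝ) • z) ((K / 2) • y)
        rw [real_inner_smul_left, real_inner_smul_right] at h2
        rw [inv_mul_eq_div, le_div_iff₀ hK0]
        nlinarith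
      · refine le_max_of_le_left ?_
        have h1 := real_inner_le_norm z y
        have h2 := mul_le_mul_of_nonneg_right hz (norm_nonneg y)
        have h3 := G.nonneg z
        linarith
    rcases le_max_iff.1 (G.conj_le hcase) with h1 | h1
    · exact absurd h1 (not_le.2 hlt)
    · exact h1

theorem smul_le_smul (G : GFunction N) {a b : ℝ} (hab : |a| ≤ b) (x : RN N) :
    G (a • x) ≤ G (b • x) := by
  rcases (abs_nonneg a).trans hab |>.eq_or_lt with hb | hb
  · have : a = 0 := by rw [← hb] at hab; simpa using hab
    rw [this, ← hb]
  have h1 := abs_le.1 hab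
  have hp : 0 ≤ (b + a) / (2 * b) := div_nonneg (by linarith) (by linarith)
  have hq : 0 ≤ (b - a) / (2 * b) := div_nonneg (by linarith) (by linarith)
  have h := G.convex.2 (Set.mem_univ (b • x)) (Set.mem_univ (-(b • x))) hp hq
    (by field_simp; ring)
  rw [G.even, ← add_smul, show (b + a) / (2 * b) + (b - a) / (2 * b) = 1 by field_simp; ring,
    one_smul] at h
  refine le_trans (le_of_eq ?_) h
  congr 1
  rw [← neg_smul, smul_smul, smul_smul, ← add_smul]
  congr 1
  field_simp
  ring

theorem smul_le_of_le_one (G : GFunction N) {a : ℝ} (ha : 0 ≤ a) (ha1 : a ≤ 1) (x : RN N) :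
    G (a • x) ≤ a * G x := by
  have h := G.convex.2 (Set.mem_univ x) (Set.mem_univ 0) ha (sub_nonneg.2 ha1) (by ring)
  simpa [G.map_zero] using h

theorem growth (G : GFunction N) (c : ℝ) :
    ∃ A B : ℝ, 0 ≤ A ∧ 0 ≤ B ∧ ∀ x, G (c • x) ≤ A + B * G x := by
  obtain ⟨K, hK, M, hM, h⟩ := G.delta2
  obtain ⟨C, hC0, hC⟩ := G.bounded_ball (2 * M)
  have hK0 : 0 ≤ K := by linarith
  have h2 : ∀ x, G ((2 : ℝ) • x) ≤ C + K * G x := by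
    intro x
    rcases le_total M ‖x‖ with hx | hx
    · linarith [h x hx]
    · have := hC ((2 : ℝ) • x) (by rw [norm_smul]; norm_num; linarith)
      have := mul_nonneg hK0 (G.nonneg x)
      linarith
  have hn : ∀ n : ℕ, ∃ A B : ℝ, 0 ≤ A ∧ 0 ≤ B ∧ ∀ x, G ((2 : ℝ) ^ n • x) ≤ A + B * G x := by
    intro n
    induction n with
    | zero => exact ⟨0, 1, le_rfl, zero_le_one, fun x => by simp⟩
    | succ n ih =>
      obtain ⟨A, B, hA, hB, hAB⟩ := ih
      refine ⟨C + K * A, K * B, by positivity, by positivity, fun x => ?_⟩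
      have h3 := h2 ((2 : ℝ) ^ n • x)
      rw [smul_smul, ← pow_succ'] at h3
      have h4 := mul_le_mul_of_nonneg_left (hAB x) hK0
      linarith
  obtain ⟨n, hn'⟩ := pow_unbounded_of_one_lt |c| (one_lt_two : (1 : ℝ) < 2)
  obtain ⟨A, B, hA, hB, hAB⟩ := hn n
  exact ⟨A, B, hA, hB, fun x => (G.smul_le_smul hn'.le x).trans (hAB x)⟩

end GFunction

section Orlicz

variable {N : ℕ} {Ω : Type*} [MeasurableSpace Ω]

/-- The modular `R_G(u) = ∫ G(u) dμ ∈ [0, ∞]`. -/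
noncomputable def modular (G : GFunction N) (μ : Measure Ω) (u : Ω → RN N) : ENNReal :=
  ∫⁻ t, ENNReal.ofReal (G (u t)) ∂μ

theorem modular_congr (G : GFunction N) {μ : Measure Ω} {u v : Ω → RN N} (h : u =ᵐ[μ] v) :
    modular G μ u = modular G μ v :=
  lintegral_congr_ae (h.mono fun t ht => by simp only [ht])

theorem modular_convex (G : GFunction N) {μ : Measure Ω} {u v : Ω → RN N}
    (hu : AEStronglyMeasurable u μ) {a b : ℝ} (ha : 0 ≤ a) (hb : 0 ≤ b) (hab : a + b = 1) :
    modular G μ (fun t => a • u t + b • v t) ≤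
      ENNReal.ofReal a * modular G μ u + ENNReal.ofReal b * modular G μ v := by
  have hm : AEMeasurable (fun t => ENNReal.ofReal (G (u t))) μ :=
    (G.continuous.comp_aestronglyMeasurable hu).aemeasurable.ennreal_ofReal
  unfold modular
  rw [← lintegral_const_mul' _ _ ENNReal.ofReal_ne_top,
    ← lintegral_const_mul' _ _ ENNReal.ofReal_ne_top,
    ← lintegral_add_left' (hm.const_mul _)]
  refine lintegral_mono fun t => ?_
  simp only
  rw [← ENNReal.ofReal_mul ha, ← ENNReal.ofReal_mul hb,
    ← ENNReal.ofReal_add (mul_nonneg ha (G.nonneg _)) (mul_nonneg hb (G.nonneg _))]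
  exact ENNReal.ofReal_le_ofReal (G.convex.2 (Set.mem_univ _) (Set.mem_univ _) ha hb hab)

theorem modular_smul_le (G : GFunction N) {μ : Measure Ω} (u : Ω → RN N) {a : ℝ} (ha : 0 ≤ a)
    (ha1 : a ≤ 1) : modular G μ (fun t => a • u t) ≤ ENNReal.ofReal a * modular G μ u := by
  unfold modular
  rw [← lintegral_const_mul' _ _ ENNReal.ofReal_ne_top]
  refine lintegral_mono fun t => ?_
  simp only
  rw [← ENNReal.ofReal_mul ha]
  exact ENNReal.ofReal_le_ofReal (G.smul_le_of_le_one ha ha1 _)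

theorem modular_smul_lt_top (G : GFunction N) {μ : Measure Ω} [IsFiniteMeasure μ] {u : Ω → RN N}
    (h : modular G μ u < ⊤) (c : ℝ) : modular G μ (fun t => c • u t) < ⊤ := by
  obtain ⟨A, B, hA, hB, hAB⟩ := G.growth c
  have : modular G μ (fun t => c • u t) ≤
      ∫⁻ t, (ENNReal.ofReal A + ENNReal.ofReal B * ENNReal.ofReal (G (u t))) ∂μ := by
    refine lintegral_mono fun t => ?_
    simp only
    rw [← ENNReal.ofReal_mul hB, ← ENNReal.ofReal_add hA (mul_nonneg hB (G.nonneg _))]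
    exact ENNReal.ofReal_le_ofReal (hAB _)
  refine this.trans_lt ?_
  rw [lintegral_add_left measurable_const, lintegral_const,
    lintegral_const_mul' _ _ ENNReal.ofReal_ne_top]
  exact ENNReal.add_lt_top.2 ⟨ENNReal.mul_lt_top ENNReal.ofReal_lt_top (measure_lt_top _ _),
    ENNReal.mul_lt_top ENNReal.ofReal_lt_top h⟩

/-- The linear space of classes (modulo equality a.e.) of measurable `u` with `∫ G(u) dμ < ∞`. -/
noncomputable def orliczSubmodule (G : GFunction N) (μ : Measure Ω) [IsFiniteMeasure μ] :
    Submodule ℝ (Ω →ₘ[μ] RN N) where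
  carrier := {u | modular G μ u < ⊤}
  zero_mem' := by
    have : modular G μ ((0 : Ω →ₘ[μ] RN N) : Ω → RN N) = modular G μ (fun _ => 0) :=
      modular_congr G AEEqFun.coeFn_zero
    change modular G μ _ < ⊤
    rw [this]
    simp [modular, G.map_zero]
  add_mem' := by
    intro u v hu hv
    have e : ((u + v : Ω →ₘ[μ] RN N) : Ω → RN N) =ᵐ[μ]
        fun t => (2⁻¹ : ℝ) • ((2 : ℝ) • u t) + (2⁻¹ : ℝ) • ((2 : ℝ) • v t) := by
      filter_upwards [AEEqFun.coeFn_add u v] with t ht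
      simp [ht]
    change modular G μ _ < ⊤
    rw [modular_congr G e]
    refine (modular_convex G (u.aestronglyMeasurable.const_smul (2 : ℝ)) (by norm_num)
      (by norm_num) (by norm_num)).trans_lt ?_
    exact ENNReal.add_lt_top.2
      ⟨ENNReal.mul_lt_top ENNReal.ofReal_lt_top (modular_smul_lt_top G hu 2),
        ENNReal.mul_lt_top ENNReal.ofReal_lt_top (modular_smul_lt_top G hv 2)⟩
  smul_mem' := by
    intro c u hu
    change modular G μ _ < ⊤
    rw [modular_congr G (AEEqFun.coeFn_smul c u)]
    exact modular_smul_lt_top G hu c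

/-- The anisotropic Orlicz space `L^G(Ω, μ; ℝ^N)`, normed below by the Luxemburg norm. -/
def OrliczSpace (G : GFunction N) (μ : Measure Ω) [IsFiniteMeasure μ] : Type _ :=
  orliczSubmodule G μ

namespace OrliczSpace

variable {G : GFunction N} {μ : Measure Ω} [IsFiniteMeasure μ]

noncomputable instance : AddCommGroup (OrliczSpace G μ) :=
  inferInstanceAs (AddCommGroup (orliczSubmodule G μ))

noncomputable instance : Module ℝ (OrliczSpace G μ) :=
  inferInstanceAs (Module ℝ (orliczSubmodule G μ))

/-- The underlying class of functions modulo equality a.e. -/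
def toAEEqFun (u : OrliczSpace G μ) : Ω →ₘ[μ] RN N := Subtype.val u

/-- A representative of the class. -/
noncomputable instance : CoeFun (OrliczSpace G μ) (fun _ => Ω → RN N) :=
  ⟨fun u => u.toAEEqFun⟩

theorem modular_lt_top (u : OrliczSpace G μ) : modular G μ u < ⊤ := Subtype.prop u

theorem aesm (u : OrliczSpace G μ) : AEStronglyMeasurable u μ := u.toAEEqFun.aestronglyMeasurable

theorem coeFn_add (u v : OrliczSpace G μ) : ⇑(u + v).toAEEqFun =ᵐ[μ] fun t => u t + v t :=
  AEEqFun.coeFn_add u.toAEEqFun v.toAEEqFun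

theorem coeFn_smul (c : ℝ) (u : OrliczSpace G μ) : ⇑(c • u).toAEEqFun =ᵐ[μ] fun t => c • u t :=
  AEEqFun.coeFn_smul c u.toAEEqFun

theorem coeFn_zero : ⇑(0 : OrliczSpace G μ).toAEEqFun =ᵐ[μ] fun _ => 0 :=
  AEEqFun.coeFn_zero (μ := μ) (β := RN N)

theorem ext_ae {u v : OrliczSpace G μ} (h : ⇑u.toAEEqFun =ᵐ[μ] v) : u = v :=
  Subtype.ext (AEEqFun.ext h)

/-- The `α > 0` with `∫ G(u/α) dμ ≤ 1`. -/
def admissible (u : OrliczSpace G μ) : Set ℝ :=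
  {α : ℝ | 0 < α ∧ modular G μ (fun t => α⁻¹ • u t) ≤ 1}

/-- The Luxemburg norm `inf {α > 0 : ∫ G(u/α) dμ ≤ 1}`. -/
noncomputable def luxemburg (u : OrliczSpace G μ) : ℝ := sInf (admissible u)

theorem admissible_bddBelow (u : OrliczSpace G μ) : BddBelow (admissible u) :=
  ⟨0, fun _ h => h.1.le⟩

theorem admissible_nonempty (u : OrliczSpace G μ) : (admissible u).Nonempty := by
  set r := (modular G μ u).toReal with hr
  have hr0 : 0 ≤ r := ENNReal.toReal_nonneg
  refine ⟨r + 1, by positivity, ?_⟩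
  refine (modular_smul_le G _ (by positivity) (inv_le_one_of_one_le₀ (by linarith))).trans ?_
  rw [← ENNReal.ofReal_toReal u.modular_lt_top.ne, ← hr, ← ENNReal.ofReal_mul (by positivity),
    ← ENNReal.ofReal_one]
  refine ENNReal.ofReal_le_ofReal ?_
  rw [inv_mul_le_iff₀ (by positivity)]
  linarith

theorem luxemburg_le {u : OrliczSpace G μ} {α : ℝ} (h : α ∈ admissible u) : luxemburg u ≤ α :=
  csInf_le (admissible_bddBelow u) h

theorem admissible_of_luxemburg_lt {u : OrliczSpace G μ} {α : ℝ} (h : luxemburg u < α) :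
    α ∈ admissible u := by
  obtain ⟨β, hβ, hlt⟩ := exists_lt_of_csInf_lt (admissible_nonempty u) h
  refine ⟨hβ.1.trans hlt, le_trans (lintegral_mono fun t => ENNReal.ofReal_le_ofReal ?_) hβ.2⟩
  refine G.smul_le_smul ?_ _
  rw [abs_of_pos (inv_pos.2 (hβ.1.trans hlt))]
  exact inv_anti₀ hβ.1 hlt.le

theorem luxemburg_nonneg (u : OrliczSpace G μ) : 0 ≤ luxemburg u :=
  Real.sInf_nonneg fun _ h => h.1.le

theorem luxemburg_zero : luxemburg (0 : OrliczSpace G μ) = 0 := by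
  refine le_antisymm (le_of_forall_pos_le_add fun ε hε => ?_) (luxemburg_nonneg _)
  rw [zero_add]
  refine luxemburg_le ⟨hε, ?_⟩
  have e : (fun t => ε⁻¹ • (0 : OrliczSpace G μ) t) =ᵐ[μ] fun _ => 0 := by
    filter_upwards [coeFn_zero (G := G) (μ := μ)] with t ht
    simp [ht]
  rw [modular_congr G e]
  simp [modular, G.map_zero]

theorem luxemburg_add_le (u v : OrliczSpace G μ) :
    luxemburg (u + v) ≤ luxemburg u + luxemburg v := by
  refine le_of_forall_pos_le_add fun ε hε => ?_
  obtain ⟨h1, h1'⟩ := admissible_of_luxemburg_lt (u := u) (lt_add_of_pos_right _ (half_pos hε))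
  obtain ⟨h2, h2'⟩ := admissible_of_luxemburg_lt (u := v) (lt_add_of_pos_right _ (half_pos hε))
  set α := luxemburg u + ε / 2
  set β := luxemburg v + ε / 2
  have hs : luxemburg u + luxemburg v + ε = α + β := by simp only [α, β]; ring
  rw [hs]
  refine luxemburg_le ⟨by positivity, ?_⟩
  have e : (fun t => (α + β)⁻¹ • (u + v) t) =ᵐ[μ]
      fun t => (α / (α + β)) • (α⁻¹ • u t) + (β / (α + β)) • (β⁻¹ • v t) := by
    filter_upwards [coeFn_add u v] with t ht
    rw [ht, smul_smul, smul_smul, smul_add]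
    congr 2 <;> field_simp
  rw [modular_congr G e]
  have hαβ : α / (α + β) + β / (α + β) = 1 := by field_simp
  refine (modular_convex G (u.aesm.const_smul α⁻¹) (by positivity) (by positivity) hαβ).trans ?_
  refine (add_le_add (mul_le_mul' le_rfl h1') (mul_le_mul' le_rfl h2')).trans ?_
  rw [mul_one, mul_one, ← ENNReal.ofReal_add (by positivity) (by positivity), hαβ,
    ENNReal.ofReal_one]

theorem luxemburg_smul_le (c : ℝ) (u : OrliczSpace G μ) :
    luxemburg (c • u) ≤ |c| * luxemburg u := by
  by_cases hc : c = 0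
  · simp [hc, luxemburg_zero]
  have hc0 : 0 < |c| := abs_pos.2 hc
  rw [← div_le_iff₀' hc0]
  refine le_csInf (admissible_nonempty u) fun α hα => ?_
  rw [div_le_iff₀' hc0]
  refine luxemburg_le ⟨mul_pos hc0 hα.1, ?_⟩
  have e : (fun t => (|c| * α)⁻¹ • (c • u) t) =ᵐ[μ] fun t => ((|c| * α)⁻¹ * c) • u t := by
    filter_upwards [coeFn_smul c u] with t ht
    rw [ht, smul_smul]
  rw [modular_congr G e]
  refine le_trans (lintegral_mono fun t => ENNReal.ofReal_le_ofReal ?_) hα.2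
  refine G.smul_le_smul (le_of_eq ?_) _
  have := hα.1
  rw [abs_mul, abs_inv, abs_mul, abs_abs, abs_of_pos this]
  field_simp

theorem eq_zero_of_luxemburg {u : OrliczSpace G μ} (h : luxemburg u = 0) : u = 0 := by
  have hadm : ∀ k : ℝ, 0 < k → modular G μ (fun t => k • u t) ≤ 1 := fun k hk => by
    have := (admissible_of_luxemburg_lt (u := u) (α := k⁻¹) (by rw [h]; positivity)).2
    rwa [inv_inv] at this
  have hz : ∀ k : ℝ, 0 < k → modular G μ (fun t => k • u t) = 0 := fun k hk => by
    refine le_antisymm (ENNReal.le_of_forall_pos_le_add fun ε hε _ => ?_) bot_le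
    rw [zero_add]
    set δ : ℝ := min (ε : ℝ) 1
    have hδ : 0 < δ := lt_min (by exact_mod_cast hε) one_pos
    have h1 := modular_smul_le G (μ := μ) (fun t => (δ⁻¹ * k) • u t) hδ.le (min_le_right _ _)
    simp only [smul_smul, mul_inv_cancel_left₀ hδ.ne'] at h1
    refine h1.trans ((mul_le_mul' le_rfl (hadm _ (by positivity))).trans ?_)
    rw [mul_one, ← ENNReal.ofReal_coe_nnreal]
    exact ENNReal.ofReal_le_ofReal (min_le_left _ _)
  have hae : ∀ᵐ t ∂μ, ∀ n : ℕ, G (((n : ℝ) + 1) • u t) = 0 := by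
    refine ae_all_iff.2 fun n => ?_
    have h0 := hz ((n : ℝ) + 1) (by positivity)
    have hm : AEMeasurable (fun t => ENNReal.ofReal (G (((n : ℝ) + 1) • u t))) μ :=
      (G.continuous.comp_aestronglyMeasurable
        (u.aesm.const_smul ((n : ℝ) + 1))).aemeasurable.ennreal_ofReal
    filter_upwards [(lintegral_eq_zero_iff' hm).1 h0] with t ht
    exact le_antisymm (ENNReal.ofReal_eq_zero.1 ht) (G.nonneg _)
  refine ext_ae ?_
  filter_upwards [hae, coeFn_zero (G := G) (μ := μ)] with t ht h0
  rw [h0]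
  by_contra hne
  have hpos : 0 < ‖u t‖ := norm_pos_iff.2 hne
  obtain ⟨R, hR0, hR⟩ := G.superlinear 1
  obtain ⟨n, hn⟩ := exists_nat_ge (R / ‖u t‖)
  have hn' : R ≤ ‖((n : ℝ) + 1) • u t‖ := by
    rw [norm_smul, Real.norm_of_nonneg (by positivity)]
    rw [div_le_iff₀ hpos] at hn
    linarith
  have := hR _ hn'
  rw [ht n] at this
  linarith

/-- The Luxemburg norm, as a norm on the additive group `L^G`. -/
noncomputable def luxemburgNorm (G : GFunction N) (μ : Measure Ω) [IsFiniteMeasure μ] :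
    AddGroupNorm (OrliczSpace G μ) where
  toFun := luxemburg
  map_zero' := luxemburg_zero
  add_le' := luxemburg_add_le
  neg' := by
    have key : ∀ u : OrliczSpace G μ, luxemburg (-u) ≤ luxemburg u := fun u => by
      have := luxemburg_smul_le (-1) u
      simpa using this
    intro u
    refine le_antisymm (key u) ?_
    simpa using key (-u)
  eq_zero_of_map_eq_zero' := fun _ h => eq_zero_of_luxemburg h

noncomputable instance : NormedAddCommGroup (OrliczSpace G μ) :=
  (luxemburgNorm G μ).toNormedAddCommGroup

theorem norm_def (u : OrliczSpace G μ) :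
    ‖u‖ = sInf {α : ℝ | 0 < α ∧ ∫⁻ t, ENNReal.ofReal (G (α⁻¹ • u t)) ∂μ ≤ 1} := rfl

noncomputable instance : NormedSpace ℝ (OrliczSpace G μ) where
  norm_smul_le := luxemburg_smul_le

end OrliczSpace

end Orlicz

/-! The argument works over any finite measure. Fenchel's inequality |⟨x, y⟩| ≤ G x + G* y makes ⟨u,
v⟩ integrable; applied after scaling u and v to modular at most one, it gives Hölder's inequality
with constant 2, hence ‖F_v‖ ≤ 2‖v‖.

The reverse bound rests on `modular_conj_le_one`. Suppose v pairs with simple functions like a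
functional of norm at most c. The supremum defining G*(v/c) is approached from below, pointwise, by
⟨z n, v/c⟩ − G(z n) with z n simple. Since ‖z‖ ≤ ∫ G(z) + 1, each of these functions has integral at
most 1, and Fatou's lemma gives ∫ G*(v/c) ≤ 1.

That lemma does not presuppose v ∈ L^{G*}, so it also yields surjectivity. Radon–Nikodym applied to
A ↦ F(x · 1_A) produces an integrable density v representing F on simple functions; the lemma places
v in L^{G*}; density of simple functions, which uses Δ₂, extends the formula to all of L^G. Both the
density argument and the duality bound take their simple functions from
`exists_simpleFunc_minimizing`. -/

/-! ### Near-optimal selection by simple functions -/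

section Minimizers

variable {E : Type*} [TopologicalSpace E] [SecondCountableTopology E]
  [MeasurableSpace E] [BorelSpace E] [Zero E]

/-- Simple functions that select, among finitely many points of `E`, increasing to a dense set,
a near-minimizer of `f · y`; the point `0` is always among the competitors. -/
theorem exists_simpleFunc_minimizing (f : E → E → ℝ) (hf : Continuous (Function.uncurry f)) :
    ∃ s : ℕ → SimpleFunc E E, (∀ n y, f (s n y) y ≤ f 0 y) ∧
      ∀ x y, ∀ ε > 0, ∀ᶠ n in atTop, f (s n y) y ≤ f x y + ε := by
  classical
  have : Nonempty E := ⟨0⟩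
  set d : ℕ → E := TopologicalSpace.denseSeq E
  have hm : ∀ g h : SimpleFunc E E, MeasurableSet {y | f (g y) y < f (h y) y} := fun g h =>
    measurableSet_lt (hf.measurable.comp (g.measurable.prodMk measurable_id))
      (hf.measurable.comp (h.measurable.prodMk measurable_id))
  -- Stage n + 1 switches to `d n` exactly where this strictly lowers the value, and otherwise keeps
  -- the previous choice.
  let s : ℕ → SimpleFunc E E := fun n => Nat.rec (SimpleFunc.const E 0)
    (fun n g => SimpleFunc.piecewise _ (hm (SimpleFunc.const E (d n)) g)
      (SimpleFunc.const E (d n)) g) n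
  have hs : ∀ n y, f (s (n + 1) y) y ≤ f (s n y) y ∧ f (s (n + 1) y) y ≤ f (d n) y := by
    intro n y
    have e : s (n + 1) = SimpleFunc.piecewise _ (hm (SimpleFunc.const E (d n)) (s n))
      (SimpleFunc.const E (d n)) (s n) := rfl
    rw [e, SimpleFunc.piecewise_apply]
    split_ifs with h
    · exact ⟨(show f (d n) y < f (s n y) y from h).le, le_rfl⟩
    · exact ⟨le_rfl, not_lt.1 h⟩
  have hanti : ∀ y, Antitone fun n => f (s n y) y := fun y =>
    antitone_nat_of_succ_le fun n => (hs n y).1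
  refine ⟨s, fun n y => hanti y n.zero_le, fun x y ε hε => ?_⟩
  have ho : IsOpen {z | f z y < f x y + ε} :=
    isOpen_lt (hf.comp (Continuous.prodMk_left y)) continuous_const
  obtain ⟨k, hk⟩ := (TopologicalSpace.denseRange_denseSeq E).exists_mem_open ho
    ⟨x, show f x y < f x y + ε by linarith⟩
  -- The point `d k` enters the competition only at stage k + 1.
  filter_upwards [eventually_ge_atTop (k + 1)] with n hn
  exact ((hanti y hn).trans (hs k y).2).trans (le_of_lt hk)

end Minimizers

/-! ### Fenchel's inequality and integrability from finite modulars -/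

namespace GFunction

variable {N : ℕ}

theorem inner_le_add_conj (G : GFunction N) (x y : RN N) : ⟪x, y⟫ ≤ G x + G.conj y := by
  have := G.le_conj x y
  change _ ≤ G x + G.conjFun y
  linarith

theorem abs_inner_le_add_conj (G : GFunction N) (x y : RN N) : |⟪x, y⟫| ≤ G x + G.conj y := by
  refine abs_le.2 ⟨?_, G.inner_le_add_conj x y⟩
  have := G.inner_le_add_conj (-x) y
  rw [inner_neg_left, G.even] at this
  linarith

end GFunction

section Modular

variable {N : ℕ} {Ω : Type*} [MeasurableSpace Ω] {μ : Measure Ω}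

theorem integrable_of_modular_lt_top (G : GFunction N) {u : Ω → RN N}
    (hu : AEStronglyMeasurable u μ) (h : modular G μ u < ⊤) : Integrable (fun t => G (u t)) μ := by
  refine ⟨G.continuous.comp_aestronglyMeasurable hu, ?_⟩
  rw [hasFiniteIntegral_iff_ofReal (ae_of_all _ fun _ => G.nonneg _)]
  exact h

theorem toReal_modular (G : GFunction N) {u : Ω → RN N} (hu : AEStronglyMeasurable u μ) :
    (modular G μ u).toReal = ∫ t, G (u t) ∂μ :=
  (integral_eq_lintegral_of_nonneg_ae (ae_of_all _ fun _ => G.nonneg _)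
    (G.continuous.comp_aestronglyMeasurable hu)).symm

theorem modular_simpleFunc_lt_top [IsFiniteMeasure μ] (G : GFunction N) (s : SimpleFunc Ω (RN N)) :
    modular G μ s < ⊤ := by
  obtain ⟨C, hC⟩ := s.exists_forall_norm_le
  obtain ⟨D, -, hD⟩ := G.bounded_ball C
  refine (lintegral_mono fun t => ENNReal.ofReal_le_ofReal (hD _ (hC t))).trans_lt ?_
  rw [lintegral_const]
  exact ENNReal.mul_lt_top ENNReal.ofReal_lt_top (measure_lt_top _ _)

theorem integrable_simpleFunc_inner {v : Ω → RN N} (hv : Integrable v μ)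
    (s : SimpleFunc Ω (RN N)) : Integrable (fun t => ⟪s t, v t⟫) μ := by
  obtain ⟨C, hC⟩ := s.exists_forall_norm_le
  refine (hv.norm.const_mul C).mono' (s.aestronglyMeasurable.inner hv.aestronglyMeasurable)
    (ae_of_all _ fun t => (norm_inner_le_norm _ _).trans ?_)
  exact mul_le_mul_of_nonneg_right (hC t) (norm_nonneg _)

end Modular

/-! ### Hölder's inequality, density of simple functions, and the two norm bounds -/

namespace OrliczSpace

variable {N : ℕ} {Ω : Type*} [MeasurableSpace Ω] {G : GFunction N} {μ : Measure Ω}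
  [IsFiniteMeasure μ]

/-- The class of a function of finite modular. -/
noncomputable def mk (G : GFunction N) (u : Ω → RN N) (hu : AEStronglyMeasurable u μ)
    (h : modular G μ u < ⊤) : OrliczSpace G μ :=
  ⟨AEEqFun.mk u hu, by
    change modular G μ _ < ⊤
    rwa [modular_congr G (AEEqFun.coeFn_mk u hu)]⟩

theorem coeFn_mk (u : Ω → RN N) (hu : AEStronglyMeasurable u μ) (h : modular G μ u < ⊤) :
    ⇑(mk G u hu h).toAEEqFun =ᵐ[μ] u := AEEqFun.coeFn_mk u hu

/-- The class of a simple function. -/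
noncomputable def ofSimpleFunc (G : GFunction N) (μ : Measure Ω) [IsFiniteMeasure μ]
    (s : SimpleFunc Ω (RN N)) : OrliczSpace G μ :=
  mk G s s.aestronglyMeasurable (modular_simpleFunc_lt_top G s)

theorem coeFn_ofSimpleFunc (s : SimpleFunc Ω (RN N)) :
    ⇑(ofSimpleFunc G μ s).toAEEqFun =ᵐ[μ] s := coeFn_mk _ _ _

theorem ofSimpleFunc_add (s t : SimpleFunc Ω (RN N)) :
    ofSimpleFunc G μ (s + t) = ofSimpleFunc G μ s + ofSimpleFunc G μ t := by
  refine ext_ae ?_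
  filter_upwards [coeFn_ofSimpleFunc (G := G) (μ := μ) (s + t), coeFn_ofSimpleFunc (G := G) (μ := μ)
    s, coeFn_ofSimpleFunc (G := G) (μ := μ) t,
    coeFn_add (ofSimpleFunc G μ s) (ofSimpleFunc G μ t)] with x h1 h2 h3 h4
  rw [h1, h4, h2, h3, SimpleFunc.add_apply]

theorem ofSimpleFunc_smul (c : ℝ) (s : SimpleFunc Ω (RN N)) :
    ofSimpleFunc G μ (c • s) = c • ofSimpleFunc G μ s := by
  refine ext_ae ?_
  filter_upwards [coeFn_ofSimpleFunc (G := G) (μ := μ) (c • s), coeFn_ofSimpleFunc (G := G) (μ := μ)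
    s, coeFn_smul c (ofSimpleFunc G μ s)] with x h1 h2 h4
  rw [h1, h4, h2, SimpleFunc.smul_apply]

theorem norm_le {u : OrliczSpace G μ} {α : ℝ} (hα : 0 < α)
    (h : modular G μ (fun t => α⁻¹ • u t) ≤ 1) : ‖u‖ ≤ α := luxemburg_le ⟨hα, h⟩

theorem modular_le_one_of_norm_lt {u : OrliczSpace G μ} {α : ℝ} (h : ‖u‖ < α) :
    modular G μ (fun t => α⁻¹ • u t) ≤ 1 := (admissible_of_luxemburg_lt h).2

/-- By convexity and G 0 = 0, dividing u by r + 1, with r its modular, leaves modular at most r/(r +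
1) ≤ 1. The added 1 becomes the bound 1 on the conjugate modular in `modular_conj_le_one`. -/
theorem norm_le_modular_add_one (u : OrliczSpace G μ) : ‖u‖ ≤ (modular G μ u).toReal + 1 := by
  set r := (modular G μ u).toReal with hr
  have hr0 : 0 ≤ r := ENNReal.toReal_nonneg
  refine norm_le (by positivity) ?_
  refine (modular_smul_le G _ (by positivity) (inv_le_one_of_one_le₀ (by linarith))).trans ?_
  rw [← ENNReal.ofReal_toReal u.modular_lt_top.ne, ← hr, ← ENNReal.ofReal_mul (by positivity),
    ← ENNReal.ofReal_one]
  refine ENNReal.ofReal_le_ofReal ?_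
  rw [inv_mul_le_iff₀ (by positivity)]
  linarith

theorem integrable_inner (u : OrliczSpace G μ) (v : OrliczSpace G.conj μ) :
    Integrable (fun t => ⟪u t, v t⟫) μ := by
  refine ((integrable_of_modular_lt_top G u.aesm u.modular_lt_top).add
    (integrable_of_modular_lt_top G.conj v.aesm v.modular_lt_top)).mono'
    (u.aesm.inner v.aesm) (ae_of_all _ fun t => ?_)
  exact G.abs_inner_le_add_conj _ _

/-- The Hölder inequality. -/
theorem abs_integral_inner_le (u : OrliczSpace G μ) (v : OrliczSpace G.conj μ) :
    |∫ t, ⟪u t, v t⟫ ∂μ| ≤ 2 * ‖v‖ * ‖u‖ := by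
  -- Strict upper bounds avoid deciding whether the Luxemburg infimum is attained and cover zero
  -- norms; they are then shrunk to the norms.
  have key : ∀ α β : ℝ, ‖u‖ < α → ‖v‖ < β → |∫ t, ⟪u t, v t⟫ ∂μ| ≤ 2 * β * α := by
    intro α β hα hβ
    have hα0 : 0 < α := (norm_nonneg u).trans_lt hα
    have hβ0 : 0 < β := (norm_nonneg v).trans_lt hβ
    have h1 := modular_le_one_of_norm_lt hα
    have h2 := modular_le_one_of_norm_lt hβ
    have i1 := integrable_of_modular_lt_top G (u.aesm.const_smul α⁻¹)
      (h1.trans_lt ENNReal.one_lt_top)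
    have i2 := integrable_of_modular_lt_top G.conj (v.aesm.const_smul β⁻¹)
      (h2.trans_lt ENNReal.one_lt_top)
    have e1 := toReal_modular (μ := μ) G (u.aesm.const_smul α⁻¹)
    have e2 := toReal_modular (μ := μ) G.conj (v.aesm.const_smul β⁻¹)
    have r1 : (modular G μ (α⁻¹ • ⇑u.toAEEqFun)).toReal ≤ 1 :=
      ENNReal.toReal_le_of_le_ofReal zero_le_one (by rw [ENNReal.ofReal_one]; exact h1)
    have r2 : (modular G.conj μ (β⁻¹ • ⇑v.toAEEqFun)).toReal ≤ 1 :=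
      ENNReal.toReal_le_of_le_ofReal zero_le_one (by rw [ENNReal.ofReal_one]; exact h2)
    -- The constant 2 is the sum of the two modular bounds.
    have h3 : |∫ t, ⟪α⁻¹ • u t, β⁻¹ • v t⟫ ∂μ| ≤ 2 := by
      refine (abs_integral_le_integral_abs).trans ?_
      refine (integral_mono_of_nonneg (ae_of_all _ fun t => abs_nonneg _) (i1.add i2)
        (ae_of_all _ fun t => G.abs_inner_le_add_conj _ _)).trans ?_
      rw [integral_add' i1 i2]
      linarith
    have h4 : ∀ t, ⟪α⁻¹ • u t, β⁻¹ • v t⟫ = (β * α)⁻¹ * ⟪u t, v t⟫ := fun t => by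
      rw [real_inner_smul_left, real_inner_smul_right]
      field_simp
    simp only [h4] at h3
    rw [integral_const_mul, abs_mul, abs_of_pos (by positivity), inv_mul_le_iff₀ (by positivity)]
      at h3
    linarith
  have ht : Tendsto (fun ε : ℝ => 2 * (‖v‖ + ε) * (‖u‖ + ε)) (𝓝[>] 0) (𝓝 (2 * ‖v‖ * ‖u‖)) := by
    have : Continuous fun ε : ℝ => 2 * (‖v‖ + ε) * (‖u‖ + ε) := by fun_prop
    simpa using (this.tendsto 0).mono_left nhdsWithin_le_nhds
  refine ge_of_tendsto ht (eventually_mem_nhdsWithin.mono fun ε hε => ?_)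
  have hε : 0 < ε := hε
  exact key _ _ (by linarith) (by linarith)

/-- The functional `u ↦ ∫ ⟨u, v⟩ dμ`. -/
noncomputable def pairing (v : OrliczSpace G.conj μ) : StrongDual ℝ (OrliczSpace G μ) :=
  LinearMap.mkContinuous
    { toFun := fun u => ∫ t, ⟪u t, v t⟫ ∂μ
      map_add' := fun u w => by
        rw [← integral_add (integrable_inner u v) (integrable_inner w v)]
        refine integral_congr_ae ?_
        filter_upwards [coeFn_add u w] with t ht
        rw [ht, inner_add_left]
      map_smul' := fun c u => by
        rw [RingHom.id_apply, smul_eq_mul, ← integral_const_mul]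
        refine integral_congr_ae ?_
        filter_upwards [coeFn_smul c u] with t ht
        rw [ht, real_inner_smul_left] }
    (2 * ‖v‖) fun u => abs_integral_inner_le u v

theorem pairing_apply (v : OrliczSpace G.conj μ) (u : OrliczSpace G μ) :
    pairing v u = ∫ t, ⟪u t, v t⟫ ∂μ := rfl

theorem norm_pairing_le (v : OrliczSpace G.conj μ) : ‖pairing v‖ ≤ 2 * ‖v‖ :=
  LinearMap.mkContinuous_norm_le _ (by positivity) _

/-- `v ↦ F_v` as a linear map. -/
noncomputable def pairingₗ (G : GFunction N) (μ : Measure Ω) [IsFiniteMeasure μ] :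
    OrliczSpace G.conj μ →ₗ[ℝ] StrongDual ℝ (OrliczSpace G μ) where
  toFun := pairing
  map_add' v w := by
    ext u
    rw [_root_.add_apply, pairing_apply, pairing_apply, pairing_apply,
      ← integral_add (integrable_inner u v) (integrable_inner u w)]
    refine integral_congr_ae ?_
    filter_upwards [coeFn_add v w] with t ht
    rw [ht, inner_add_right]
  map_smul' c v := by
    ext u
    rw [RingHom.id_apply, _root_.smul_apply, pairing_apply, pairing_apply,
      smul_eq_mul, ← integral_const_mul]
    refine integral_congr_ae ?_
    filter_upwards [coeFn_smul c v] with t ht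
    rw [ht, real_inner_smul_right]

/-- Simple functions are dense in `L^G`. -/
theorem denseRange_ofSimpleFunc (G : GFunction N) (μ : Measure Ω) [IsFiniteMeasure μ] :
    DenseRange (ofSimpleFunc G μ) := by
  refine Metric.denseRange_iff.2 fun u r hr => ?_
  -- With this scale, modular at most one for m(u − w) means ‖u − w‖ ≤ r/2 < r.
  set m : ℝ := (r / 2)⁻¹ with hm
  obtain ⟨s, hs0, hs⟩ := exists_simpleFunc_minimizing (fun x y : RN N => G (m • (y - x)))
    (G.continuous.comp (by fun_prop))
  have hu : Measurable u := u.toAEEqFun.measurable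
  let w : ℕ → SimpleFunc Ω (RN N) := fun n => (s n).comp u hu
  -- Because 0 is always a competitor, G(m u) dominates every error term; its integrability is where
  -- Δ₂ enters.
  have hfin : ∫⁻ t, ENNReal.ofReal (G (m • (u t - 0))) ∂μ ≠ ⊤ := by
    simp only [sub_zero]
    exact (modular_smul_lt_top G u.modular_lt_top m).ne
  have hlim : Tendsto (fun n => ∫⁻ t, ENNReal.ofReal (G (m • (u t - w n t))) ∂μ) atTop
      (𝓝 (∫⁻ _, 0 ∂μ)) := by
    refine tendsto_lintegral_of_dominated_convergence _ (fun n => ?_)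
      (fun n => ae_of_all _ fun t => ENNReal.ofReal_le_ofReal (hs0 n (u t))) hfin
      (ae_of_all _ fun t => ?_)
    · exact (G.continuous.measurable.comp
        ((hu.sub (w n).measurable).const_smul m)).ennreal_ofReal
    · rw [← ENNReal.ofReal_zero]
      refine ENNReal.tendsto_ofReal (tendsto_order.2 ⟨fun a ha => Eventually.of_forall fun n =>
        ha.trans_le (G.nonneg _), fun a ha => ?_⟩)
      filter_upwards [hs (u t) (u t) (a / 2) (half_pos ha)] with n hn
      rw [sub_self, smul_zero, G.map_zero] at hn
      exact hn.trans_lt (by linarith)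
  rw [lintegral_zero] at hlim
  obtain ⟨n, hn⟩ := (hlim.eventually (ge_mem_nhds one_pos)).exists
  refine ⟨w n, ?_⟩
  rw [dist_eq_norm]
  refine (norm_le (half_pos hr) ?_).trans_lt (half_lt_self hr)
  refine le_trans (le_of_eq (lintegral_congr_ae ?_)) hn
  filter_upwards [coeFn_add u (-ofSimpleFunc G μ (w n)), coeFn_smul (-1) (ofSimpleFunc G μ (w n)),
    coeFn_ofSimpleFunc (G := G) (μ := μ) (w n)] with t h1 h2 h3
  rw [neg_one_smul] at h2
  rw [sub_eq_add_neg, h1, h2, h3, neg_one_smul, ← sub_eq_add_neg]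

/-- If `v` pairs with the simple functions like a functional of norm at most `c`, then `v / c` has
modular at most one. -/
theorem modular_conj_le_one {v : Ω → RN N} (hv : Measurable v) {c : ℝ} (hc : 0 < c)
    (hi : ∀ s : SimpleFunc Ω (RN N), Integrable (fun t => ⟪s t, v t⟫) μ)
    (h : ∀ s : SimpleFunc Ω (RN N), ∫ t, ⟪s t, v t⟫ ∂μ ≤ c * ‖ofSimpleFunc G μ s‖) :
    modular G.conj μ (fun t => c⁻¹ • v t) ≤ 1 := by
  set w : Ω → RN N := fun t => c⁻¹ • v t with hw
  have hwm : Measurable w := hv.const_smul c⁻¹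
  -- Minimizing G x − ⟨x, y⟩ is maximizing the expression whose supremum is G* y.
  obtain ⟨s, hs0, hs⟩ := exists_simpleFunc_minimizing (fun x y : RN N => G x - ⟪x, y⟫)
    ((G.continuous.comp continuous_fst).sub (continuous_fst.inner continuous_snd))
  let z : ℕ → SimpleFunc Ω (RN N) := fun n => (s n).comp w hwm
  -- The competitor 0 gives the value 0; nonnegativity lets the Bochner integral and the lower
  -- integral be identified.
  have hnn : ∀ n t, 0 ≤ ⟪z n t, w t⟫ - G (z n t) := fun n t => by
    have := hs0 n (w t)
    simp only [G.map_zero, inner_zero_left, sub_zero] at this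
    change 0 ≤ ⟪s n (w t), w t⟫ - G (s n (w t))
    linarith
  have hin : ∀ n t, ⟪z n t, w t⟫ = c⁻¹ * ⟪z n t, v t⟫ := fun n t => real_inner_smul_right _ _ _
  have hint1 : ∀ n, Integrable (fun t => ⟪z n t, w t⟫) μ := fun n => by
    simp only [hin]
    exact (hi _).const_mul _
  have hint2 : ∀ n, Integrable (fun t => G (z n t)) μ := fun n =>
    integrable_of_modular_lt_top G (z n).aestronglyMeasurable (modular_simpleFunc_lt_top G _)
  -- ∫⟨z, v/c⟩ ≤ ‖z‖ ≤ ∫ G(z) + 1, and ∫ G(z) cancels.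
  have hone : ∀ n, ∫⁻ t, ENNReal.ofReal (⟪z n t, w t⟫ - G (z n t)) ∂μ ≤ 1 := fun n => by
    have hsub : Integrable (fun t => ⟪z n t, w t⟫ - G (z n t)) μ := (hint1 n).sub (hint2 n)
    rw [← ofReal_integral_eq_lintegral_ofReal hsub (ae_of_all _ (hnn n)), ← ENNReal.ofReal_one]
    refine ENNReal.ofReal_le_ofReal ?_
    rw [integral_sub (hint1 n) (hint2 n), ← toReal_modular G (z n).aestronglyMeasurable]
    simp only [hin]
    rw [integral_const_mul]
    have h1 := h (z n)
    have h2 := norm_le_modular_add_one (ofSimpleFunc G μ (z n))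
    rw [modular_congr G (coeFn_ofSimpleFunc (z n))] at h2
    rw [← inv_mul_le_iff₀ hc] at h1
    linarith
  have hlim : ∀ t, Tendsto (fun n => ENNReal.ofReal (⟪z n t, w t⟫ - G (z n t))) atTop
      (𝓝 (ENNReal.ofReal (G.conj (w t)))) := fun t => by
    refine ENNReal.tendsto_ofReal (tendsto_order.2 ⟨fun a ha => ?_, fun a ha =>
      Eventually.of_forall fun n => (G.le_conj _ _).trans_lt ha⟩)
    obtain ⟨x, hx⟩ := exists_lt_of_lt_ciSup (show a < ⨆ x : RN N, (⟪x, w t⟫ - G x) from ha)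
    filter_upwards [hs x (w t) ((⟪x, w t⟫ - G x - a) / 2) (by linarith)] with n hn
    change a < ⟪s n (w t), w t⟫ - G (s n (w t))
    linarith
  calc modular G.conj μ w
      = ∫⁻ t, liminf (fun n => ENNReal.ofReal (⟪z n t, w t⟫ - G (z n t))) atTop ∂μ :=
        lintegral_congr fun t => (hlim t).liminf_eq.symm
    _ ≤ liminf (fun n => ∫⁻ t, ENNReal.ofReal (⟪z n t, w t⟫ - G (z n t)) ∂μ) atTop :=
        lintegral_liminf_le fun n => (((z n).measurable.inner hwm).sub
          (G.continuous.measurable.comp (z n).measurable)).ennreal_ofReal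
    _ ≤ 1 := liminf_le_of_le (by isBoundedDefault) fun b hb => by
        obtain ⟨n, hn⟩ := hb.exists
        exact hn.trans (hone n)

/-- Every c > ‖F_v‖ satisfies the hypotheses of `modular_conj_le_one`, so it is admissible in the
Luxemburg infimum for v. The strict inequality keeps c positive even when F_v = 0. -/
theorem norm_le_norm_pairing (v : OrliczSpace G.conj μ) : ‖v‖ ≤ ‖pairing v‖ := by
  refine le_of_forall_pos_le_add fun ε hε => ?_
  have hc : 0 < ‖pairing v‖ + ε := by positivity
  have e : ∀ s : SimpleFunc Ω (RN N),
      (fun t => ⟪ofSimpleFunc G μ s t, v t⟫) =ᵐ[μ] fun t => ⟪s t, v t⟫ := fun s => by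
    filter_upwards [coeFn_ofSimpleFunc (G := G) (μ := μ) s] with t ht
    rw [ht]
  refine norm_le hc (modular_conj_le_one v.toAEEqFun.measurable hc (fun s => ?_) fun s => ?_)
  · exact (integrable_inner (ofSimpleFunc G μ s) v).congr (e s)
  · rw [← integral_congr_ae (e s), ← pairing_apply]
    refine (le_abs_self _).trans (((pairing v).le_opNorm _).trans ?_)
    gcongr
    linarith

end OrliczSpace

/-! ### Riesz representation via Radon–Nikodym -/

namespace OrliczSpace

variable {N : ℕ} {Ω : Type*} [MeasurableSpace Ω] {G : GFunction N} {μ : Measure Ω}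
  [IsFiniteMeasure μ]

/-- The class of `x · 1_A`, linear in `x`. -/
noncomputable def indicatorₗ (G : GFunction N) (μ : Measure Ω) [IsFiniteMeasure μ] {A : Set Ω}
    (hA : MeasurableSet A) : RN N →ₗ[ℝ] OrliczSpace G μ where
  toFun x := ofSimpleFunc G μ
    (SimpleFunc.piecewise A hA (SimpleFunc.const _ x) (SimpleFunc.const _ 0))
  map_add' x y := by
    rw [← ofSimpleFunc_add]
    congr 1
    ext1 t
    by_cases ht : t ∈ A <;> simp [ht]
  map_smul' c x := by
    rw [RingHom.id_apply, ← ofSimpleFunc_smul]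
    congr 1
    ext1 t
    by_cases ht : t ∈ A <;> simp [ht]

theorem coeFn_indicatorₗ {A : Set Ω} (hA : MeasurableSet A) (x : RN N) :
    ⇑(indicatorₗ G μ hA x).toAEEqFun =ᵐ[μ] A.indicator fun _ => x := by
  classical
  refine (coeFn_ofSimpleFunc _).trans (ae_of_all _ fun t => ?_)
  by_cases ht : t ∈ A <;> simp [ht]

theorem indicatorₗ_union {A B : Set Ω} (hA : MeasurableSet A) (hB : MeasurableSet B)
    (h : Disjoint A B) (x : RN N) :
    indicatorₗ G μ (hA.union hB) x = indicatorₗ G μ hA x + indicatorₗ G μ hB x := by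
  refine ext_ae ?_
  filter_upwards [coeFn_indicatorₗ (G := G) (μ := μ) (hA.union hB) x,
    coeFn_indicatorₗ (G := G) (μ := μ) hA x, coeFn_indicatorₗ (G := G) (μ := μ) hB x,
    coeFn_add (indicatorₗ G μ hA x) (indicatorₗ G μ hB x)] with t h1 h2 h3 h4
  rw [h1, h4, h2, h3, Set.indicator_union_of_disjoint h]

theorem indicatorₗ_eq_zero {A : Set Ω} (hA : MeasurableSet A) (h : μ A = 0) (x : RN N) :
    indicatorₗ G μ hA x = 0 := by
  refine ext_ae ?_
  filter_upwards [coeFn_indicatorₗ (G := G) (μ := μ) hA x, coeFn_zero (G := G) (μ := μ),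
    measure_eq_zero_iff_ae_notMem.1 h] with t h1 h2 h3
  rw [h1, h2, Set.indicator_of_notMem h3]

theorem norm_indicatorₗ_le {A : Set Ω} (hA : MeasurableSet A) (x : RN N) {ε : ℝ} (hε : 0 < ε)
    (h : ENNReal.ofReal (G (ε⁻¹ • x)) * μ A ≤ 1) : ‖indicatorₗ G μ hA x‖ ≤ ε := by
  refine norm_le hε (le_trans (le_of_eq ?_) h)
  have e : (fun t => ε⁻¹ • indicatorₗ G μ hA x t) =ᵐ[μ] A.indicator fun _ => ε⁻¹ • x := by
    filter_upwards [coeFn_indicatorₗ (G := G) (μ := μ) hA x] with t ht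
    rw [ht]
    by_cases h : t ∈ A <;> simp [h]
  rw [modular_congr G e, modular, ← lintegral_indicator_const hA]
  refine lintegral_congr fun t => ?_
  by_cases h : t ∈ A <;> simp [h, G.map_zero]

/-- For fixed x and ε the modular of ε⁻¹ x · 1_A is G(x/ε) μ(A), which tends to 0 with μ(A). This
makes A ↦ F(x · 1_A) countably additive. -/
theorem tendsto_indicatorₗ {ι : Type*} {l : Filter ι} {A : ι → Set Ω}
    (hA : ∀ i, MeasurableSet (A i)) (h : Tendsto (fun i => μ (A i)) l (𝓝 0)) (x : RN N) :
    Tendsto (fun i => indicatorₗ G μ (hA i) x) l (𝓝 0) := by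
  refine tendsto_zero_iff_norm_tendsto_zero.2 (tendsto_order.2 ⟨fun a ha =>
    Eventually.of_forall fun i => ha.trans_le (norm_nonneg _), fun a ha => ?_⟩)
  have h1 := ENNReal.Tendsto.const_mul (a := ENNReal.ofReal (G ((a / 2)⁻¹ • x))) h
    (Or.inr ENNReal.ofReal_ne_top)
  rw [mul_zero] at h1
  filter_upwards [h1.eventually (ge_mem_nhds one_pos)] with i hi
  exact (norm_indicatorₗ_le (hA i) x (half_pos ha) hi).trans_lt (half_lt_self ha)

/-- The set function `A ↦ F(x · 1_A)`. -/
noncomputable def setFunction (F : StrongDual ℝ (OrliczSpace G μ)) (x : RN N) (A : Set Ω) : ℝ :=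
  -- The value 0 off the measurable sets is the convention required of a vector measure.
  open Classical in if hA : MeasurableSet A then F (indicatorₗ G μ hA x) else 0

theorem setFunction_apply (F : StrongDual ℝ (OrliczSpace G μ)) (x : RN N) {A : Set Ω}
    (hA : MeasurableSet A) : setFunction F x A = F (indicatorₗ G μ hA x) := dif_pos hA

theorem setFunction_eq_zero (F : StrongDual ℝ (OrliczSpace G μ)) (x : RN N) {A : Set Ω}
    (hA : MeasurableSet A) (h : μ A = 0) : setFunction F x A = 0 := by
  rw [setFunction_apply F x hA, indicatorₗ_eq_zero hA h, map_zero]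

theorem setFunction_union (F : StrongDual ℝ (OrliczSpace G μ)) (x : RN N) {A B : Set Ω}
    (hA : MeasurableSet A) (hB : MeasurableSet B) (h : Disjoint A B) :
    setFunction F x (A ∪ B) = setFunction F x A + setFunction F x B := by
  rw [setFunction_apply F x hA, setFunction_apply F x hB, setFunction_apply F x (hA.union hB),
    indicatorₗ_union hA hB h, map_add]

/-- Finite additivity leaves the tail `T s`, the union of the sets with index outside s, as the
error. Its measure is a tail of the convergent series of the μ (f i), so continuity of F sends the
error to 0. -/
theorem hasSum_setFunction (F : StrongDual ℝ (OrliczSpace G μ)) (x : RN N) {f : ℕ → Set Ω}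
    (hf : ∀ i, MeasurableSet (f i)) (hd : Pairwise (Function.onFun Disjoint f)) :
    HasSum (fun i => setFunction F x (f i)) (setFunction F x (⋃ i, f i)) := by
  classical
  have hfin : ∀ s : Finset ℕ, setFunction F x (⋃ i ∈ s, f i) = ∑ i ∈ s, setFunction F x (f i) := by
    intro s
    induction s using Finset.induction with
    | empty => simp [setFunction_eq_zero F x MeasurableSet.empty measure_empty]
    | insert a s ha ih =>
      rw [Finset.sum_insert ha, Finset.set_biUnion_insert, setFunction_union F x (hf a)
        (s.measurableSet_biUnion fun i _ => hf i), ih]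
      refine Set.disjoint_iUnion₂_right.2 fun i hi => hd ?_
      rintro rfl
      exact ha hi
  let T : Finset ℕ → Set Ω := fun s => ⋃ i : {i // i ∉ s}, f i
  have hT : ∀ s, MeasurableSet (T s) := fun s => MeasurableSet.iUnion fun i => hf i
  have hsplit : ∀ s : Finset ℕ, setFunction F x (⋃ i, f i) - setFunction F x (T s) =
      ∑ i ∈ s, setFunction F x (f i) := by
    intro s
    have e : (⋃ i, f i) = (⋃ i ∈ s, f i) ∪ T s := by
      ext t
      simp only [T, Set.mem_union, Set.mem_iUnion, Subtype.exists, exists_prop]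
      constructor
      · rintro ⟨i, hi⟩
        by_cases h : i ∈ s
        · exact Or.inl ⟨i, h, hi⟩
        · exact Or.inr ⟨i, h, hi⟩
      · rintro (⟨i, -, hi⟩ | ⟨i, -, hi⟩) <;> exact ⟨i, hi⟩
    rw [e, setFunction_union F x (s.measurableSet_biUnion fun i _ => hf i) (hT s), hfin,
      add_sub_cancel_right]
    refine Set.disjoint_iUnion₂_left.2 fun i hi => Set.disjoint_iUnion_right.2 fun j => hd ?_
    rintro rfl
    exact j.2 hi
  have hμ : Tendsto (fun s => μ (T s)) atTop (𝓝 0) := by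
    have h1 : ∑' i, μ (f i) ≠ ⊤ := by
      rw [← measure_iUnion hd hf]
      exact measure_ne_top _ _
    refine (ENNReal.tendsto_tsum_compl_atTop_zero h1).congr fun s => ?_
    exact (measure_iUnion (hd.comp_of_injective Subtype.val_injective) fun i => hf i).symm
  have h2 : Tendsto (fun s => setFunction F x (T s)) atTop (𝓝 0) := by
    have := (F.continuous.tendsto 0).comp (tendsto_indicatorₗ (G := G) hT hμ x)
    rw [map_zero] at this
    exact this.congr fun s => (setFunction_apply F x (hT s)).symm
  have h3 := (tendsto_const_nhds (x := setFunction F x (⋃ i, f i))).sub h2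
  rw [sub_zero] at h3
  exact h3.congr hsplit

/-- The signed measure `A ↦ F(x · 1_A)`. -/
noncomputable def signedMeasure (F : StrongDual ℝ (OrliczSpace G μ)) (x : RN N) :
    SignedMeasure Ω where
  measureOf' := setFunction F x
  empty' := setFunction_eq_zero F x MeasurableSet.empty measure_empty
  not_measurable' _ h := dif_neg h
  m_iUnion' _ hf hd := hasSum_setFunction F x hf hd

/-- The density of the signed measure `A ↦ F(x · 1_A)`. -/
theorem exists_density (F : StrongDual ℝ (OrliczSpace G μ)) (x : RN N) :
    ∃ r : Ω → ℝ, Measurable r ∧ Integrable r μ ∧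
      ∀ (A : Set Ω) (hA : MeasurableSet A), F (indicatorₗ G μ hA x) = ∫ t in A, r t ∂μ := by
  refine ⟨(signedMeasure F x).rnDeriv μ, SignedMeasure.measurable_rnDeriv _ _,
    SignedMeasure.integrable_rnDeriv _ _, fun A hA => ?_⟩
  have hac : signedMeasure F x ≪ᵥ μ.toENNRealVectorMeasure :=
    VectorMeasure.AbsolutelyContinuous.mk fun A hA h => by
      rw [Measure.toENNRealVectorMeasure_apply_measurable hA] at h
      exact setFunction_eq_zero F x hA h
  rw [← withDensityᵥ_apply (SignedMeasure.integrable_rnDeriv _ _) hA,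
    SignedMeasure.withDensityᵥ_rnDeriv_eq _ _ hac]
  exact (setFunction_apply F x hA).symm

/-- On simple functions, a bounded functional is given by an integrable density. -/
theorem exists_density_simpleFunc (F : StrongDual ℝ (OrliczSpace G μ)) :
    ∃ v : Ω → RN N, Measurable v ∧ Integrable v μ ∧
      ∀ s : SimpleFunc Ω (RN N), F (ofSimpleFunc G μ s) = ∫ t, ⟪s t, v t⟫ ∂μ := by
  classical
  set b := EuclideanSpace.basisFun (Fin N) ℝ
  choose r hrm hri hr using fun i => exists_density F (b i)
  have hvi : Integrable (fun t => ∑ i, r i t • b i) μ :=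
    integrable_finsetSum _ fun i _ => (hri i).smul_const _
  refine ⟨fun t => ∑ i, r i t • b i, Finset.measurable_fun_sum _ fun i _ => (hrm i).smul_const _,
    hvi, fun s => ?_⟩
  induction s using SimpleFunc.induction with
  | @const x A hA =>
    -- Linearity of x ↦ x · 1_A reduces to the basis vectors, whose scalar densities are the
    -- coordinates of v.
    have e1 : F (indicatorₗ G μ hA x) = ∑ i, ⟪b i, x⟫ * ∫ t in A, r i t ∂μ := by
      conv_lhs => rw [← b.sum_repr' x, map_sum, map_sum]
      exact Finset.sum_congr rfl fun i _ => by rw [map_smul, map_smul, hr, smul_eq_mul]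
    refine e1.trans ?_
    have e2 : ∀ t, ⟪(SimpleFunc.piecewise A hA (SimpleFunc.const _ x) (SimpleFunc.const _ 0)) t,
        ∑ i, r i t • b i⟫ = A.indicator (fun t => ∑ i, ⟪b i, x⟫ * r i t) t := fun t => by
      by_cases ht : t ∈ A
      · rw [SimpleFunc.piecewise_apply, if_pos ht, Set.indicator_of_mem ht]
        simp only [SimpleFunc.const_apply, inner_sum, real_inner_smul_right]
        exact Finset.sum_congr rfl fun i _ => by rw [real_inner_comm, mul_comm]
      · simp [ht]
    simp only [e2]
    rw [integral_indicator hA, integral_finsetSum _ fun i _ => ((hri i).integrableOn).const_mul _]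
    exact Finset.sum_congr rfl fun i _ => (integral_const_mul _ _).symm
  | @add f g _ hf hg =>
    rw [ofSimpleFunc_add, map_add, hf, hg, ← integral_add (integrable_simpleFunc_inner hvi f)
      (integrable_simpleFunc_inner hvi g)]
    simp only [SimpleFunc.coe_add, Pi.add_apply, inner_add_left]

/-- Riesz representation in `L^G`. -/
theorem pairing_surjective (F : StrongDual ℝ (OrliczSpace G μ)) :
    ∃ v : OrliczSpace G.conj μ, pairing v = F := by
  obtain ⟨v, hvm, hvi, hF⟩ := exists_density_simpleFunc F
  have hc : 0 < ‖F‖ + 1 := by positivity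
  have h1 : modular G.conj μ (fun t => (‖F‖ + 1)⁻¹ • v t) ≤ 1 := by
    refine modular_conj_le_one (G := G) hvm hc (integrable_simpleFunc_inner hvi) fun s => ?_
    rw [← hF]
    refine (le_abs_self _).trans ((F.le_opNorm _).trans ?_)
    gcongr
    linarith
  -- Scaling back by ‖F‖ + 1 preserves finiteness by Δ₂ for G*, which comes from ∇₂ for G.
  have h2 : modular G.conj μ v < ⊤ := by
    have := modular_smul_lt_top G.conj (h1.trans_lt ENNReal.one_lt_top) (‖F‖ + 1)
    simpa only [smul_smul, mul_inv_cancel₀ hc.ne', one_smul] using this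
  refine ⟨mk G.conj v hvm.aestronglyMeasurable h2, DFunLike.coe_injective ?_⟩
  -- Both functionals are continuous, so agreement on the dense simple functions suffices.
  refine (denseRange_ofSimpleFunc G μ).equalizer (pairing _).continuous F.continuous ?_
  funext s
  change pairing _ _ = F _
  rw [hF, pairing_apply]
  refine integral_congr_ae ?_
  filter_upwards [coeFn_ofSimpleFunc (G := G) (μ := μ) s,
    coeFn_mk v hvm.aestronglyMeasurable h2] with t h3 h4
  rw [h3, h4]

theorem pairingₗ_injective : Function.Injective (pairingₗ G μ) := by
  refine (injective_iff_map_eq_zero _).2 fun v hv => norm_le_zero_iff.1 ?_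
  have := norm_le_norm_pairing v
  rwa [show pairing v = 0 from hv, norm_zero] at this

/-- The linear homeomorphism `v ↦ F_v` of `L^{G*}` onto the dual of `L^G`. -/
noncomputable def dualEquiv (G : GFunction N) (μ : Measure Ω) [IsFiniteMeasure μ] :
    OrliczSpace G.conj μ ≃L[ℝ] StrongDual ℝ (OrliczSpace G μ) :=
  (LinearEquiv.ofBijective (pairingₗ G μ) ⟨pairingₗ_injective, pairing_surjective⟩)
    |>.toContinuousLinearEquivOfBounds 2 1 norm_pairing_le fun F => by
      obtain ⟨v, rfl⟩ := (LinearEquiv.ofBijective (pairingₗ G μ)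
        ⟨pairingₗ_injective, pairing_surjective⟩).surjective F
      rw [LinearEquiv.symm_apply_apply, one_mul]
      exact norm_le_norm_pairing v

end OrliczSpace

theorem mainTheorem4 {N : ℕ} (G : GFunction N) (I : Set ℝ) (hI : I.OrdConnected)
    [IsFiniteMeasure (volume.restrict I)] :
    (∀ (u : OrliczSpace G (volume.restrict I)) (v : OrliczSpace G.conj (volume.restrict I)),
      IntegrableOn (fun t => ⟪u t, v t⟫) I) ∧
    (∀ F : StrongDual ℝ (OrliczSpace G (volume.restrict I)),
      ∃! v : OrliczSpace G.conj (volume.restrict I),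
        ∀ u : OrliczSpace G (volume.restrict I), F u = ∫ t in I, ⟪u t, v t⟫) ∧
    (∃ Φ : OrliczSpace G.conj (volume.restrict I) ≃L[ℝ]
        StrongDual ℝ (OrliczSpace G (volume.restrict I)),
      (∀ (v : OrliczSpace G.conj (volume.restrict I)) (u : OrliczSpace G (volume.restrict I)),
        Φ v u = ∫ t in I, ⟪u t, v t⟫) ∧
      ∀ v : OrliczSpace G.conj (volume.restrict I), ‖v‖ ≤ ‖Φ v‖ ∧ ‖Φ v‖ ≤ 2 * ‖v‖) := by
  refine ⟨OrliczSpace.integrable_inner, fun F => ?_, OrliczSpace.dualEquiv G _, fun _ _ => rfl,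
    fun v => ⟨OrliczSpace.norm_le_norm_pairing v, OrliczSpace.norm_pairing_le v⟩⟩
  obtain ⟨v, hv⟩ := OrliczSpace.pairing_surjective F
  refine ⟨v, fun u => by rw [← hv]; rfl, fun w hw => OrliczSpace.pairingₗ_injective ?_⟩
  ext u
  exact (hw u).symm.trans (by rw [← hv]; rfl)
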